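/- **Setting.** Let $\mathcal M$ be a finite set of models and fix data $\mathbf y$ with $n\ge 1$ observations. Model $m$ has a measurable parameter space $\Theta_m\subseteq\mathbb R^{d_m}$, a likelihood $p(\mathbf y\mid\theta,m)\ge 0$ that is continuous in $\theta\in\Theta_m$ and attains its maximum over $\Theta_m$ at some $\hat\theta_m\in\Theta_m$, a prior density $p(\theta\mid m)>0$ on $\Theta_m$, and a prior probability $p(m)>0$, $\sum_m p(m)=1$. For a parameter $\theta$ let $\tilde p(\mathbf y\mid m,\theta)=p(\mathbf y\mid\theta,m)\,n^{-d_m/2}$ be the plug-in approximation of the marginal likelihood. For the models in a given (possibly empty) subset of $\mathcal M$ the exact marginal likelihood $p(\mathbf y\mid m)=\int_{\Theta_m}p(\mathbf y\mid\theta,m)p(\theta\mid m)\,d\theta$, assumed finite, is available. Put $p_L(\mathbf y\mid m)=p(\mathbf y\mid m)$ if it is available and $p_L(\mathbf y\mid m)=\tilde p(\mathbf y\mid m,\hat\theta_m)$ otherwise. For $e\in(0,\infty)^{\mathcal M}$ let $\pi_e(m)=e(m)p(m)/\sum_{m'}e(m')p(m')$. The target is $\pi=\pi_{p_L}$. **Algorithm.**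 Let $R$ be a countable set, $(w_r)_{r\in R}$ mixture weights ($w_r\ge0$, $\sum_r w_r=1$) and $q_r(\cdot\mid m)$, $r\in R$, proposal kernels on $\mathcal M$. Let $r\mapsto\bar r$ be an involution of $R$ with $w_{\bar r}=w_r$, where $\bar r$ is the component of the backward move ($\bar r=r$ for ordinary Metropolis–Hastings; for mode jumping MCMC, $r$ records the swapped indicators and the outcomes of the forward and the backward local optimisation, and $\bar r$ exchanges these outcomes). Suppose that for some $r'$ with $w_{r'}>0$ one has $q_{r'}(m^\star\mid m)>0$ and $q_{\bar r'}(m^\star\mid m)>0$ for all $m,m^\star\in\mathcal M$. Put $$\alpha_{r}(m,m^\star;e)=\min\Big\{1,\frac{e(m^\star)\,p(m^\star)\,q_{\bar r}(m\mid m^\star)}{e(m)\,p(m)\,q_r(m^\star\mid m)}\Big\}.$$ Start from any model $m^{(0)}$ and from $\hat p^{\mathrm{opt},0}(\mathbf y\mid m)=\varepsilon$ for all $m$, where $0<\varepsilon\le\min_m p_L(\mathbf y\mid m)$. In step $s=1,2,\dots$, given the past, choose $r$ with probability $w_r$ and propose $m^\star\sim q_r(\cdot\mid m^{(s-1)})$.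 Obtain a parameter $\theta_s\in\Theta_{m^\star}$ from batch stochastic gradient descent, or from any other, possibly random, optimiser, started in any way. Given all this, with probability $p_{\mathrm{rand}}\in(0,1]$ (not depending on $s$) replace $\theta_s$ by a draw from a distribution $u_{m^\star}(\theta_s,\cdot)$ around it. Here each $u_m$ is a Markov kernel such that, for every $\theta\in\Theta_m$, $u_m(\theta,\cdot)$ is concentrated on $\Theta_m$ and charges every nonempty relatively open subset of $\Theta_m$. Evaluate $\hat p^{s}(\mathbf y\mid m^\star)$, which is $\tilde p(\mathbf y\mid m^\star,\cdot)$ at the final parameter, or $p(\mathbf y\mid m^\star)$ if this is available; set $\hat p^{\mathrm{opt},s}(\mathbf y\mid m^\star)=\max\{\hat p^{\mathrm{opt},s-1}(\mathbf y\mid m^\star),\hat p^{s}(\mathbf y\mid m^\star)\}$ and $\hat p^{\mathrm{opt},s}(\mathbf y\mid m)=\hat p^{\mathrm{opt},s-1}(\mathbf y\mid m)$ for $m\ne m^\star$. Finally put $m^{(s)}=m^\star$ with (conditional) probability $\alpha_r(m^{(s-1)},m^\star;\hat p^{\mathrm{opt},s}(\mathbf y\mid\cdot))$ and $m^{(s)}=m^{(s-1)}$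 otherwise. **Conditions on the adaptive kernel.** For $e\in(0,\infty)^{\mathcal M}$ let $K_e$ be the Metropolis–Hastings transition matrix with $K_e(m,m^\star)=\sum_r w_r\,q_r(m^\star\mid m)\,\alpha_r(m,m^\star;e)$ for $m^\star\neq m$. With $e_t=\hat p^{\mathrm{opt},t}(\mathbf y\mid\cdot)$, the adaptive transition kernel at time $t$ is $K_{e_t}$, with stationary law $\pi^t=\pi_{e_t}$. Assume: * (A3) there are $V:\mathcal M\to[1,\infty)$ and, for every $e$, constants $C_e<\infty$ and $\rho_e\in(0,1)$ with $\sum_{m'}|K_e^k(m,m')-\pi_e(m')|\,V(m')\le C_e\,\rho_e^k\,V(m)$ for all $k\ge0$ and $m\in\mathcal M$; and, for some nonrandom $e_\star\in(0,\infty)^{\mathcal M}$, almost surely (with $\mathcal M$ discrete) * (i) $\limsup_t C_{e_t}<\infty$ and $\limsup_t\rho_{e_t}<1$; * (ii) for every $m$, $K_{e_t}(m,\cdot)$ converges weakly to $K_{e_\star}(m,\cdot)$ as $t\to\infty$; * (iii) for every bounded continuous $f:\mathcal M\to\mathbb R$ the family $\{K_{e_t}f:t\ge0\}$ is equicontinuous.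 **Conclusion.** Almost surely, for every $m\in\mathcal M$, $$\hat p^{(t)}_{MC}(m\mid\mathbf y)=\frac1t\sum_{s=1}^t\mathbb 1\big(m^{(s)}=m\big)\longrightarrow\pi(m)\qquad(t\to\infty).$$ -/

import Mathlib

open MeasureTheory ProbabilityTheory Filter Topology

namespace SubsamplingMCMC

noncomputable section

/-- A Bayesian model class with index set `M`, for one fixed data set of `n` observations.
Model `m` has a parameter space `Θ m ⊆ ℝ ^ dim m`, the likelihood `lik m θ = p(y | θ, m)` of the
data as a function of the parameter, a prior density `prior m θ = p(θ | m)` and a prior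
probability `modelPrior m = p(m)`. `avail` is the set of models whose marginal likelihood
`p(y | m)` is available in closed form, and `mle m` is a maximum likelihood estimate. -/
structure ModelClass (M : Type*) [Fintype M] where
  /-- number of observations -/
  n : ℕ
  n_pos : 0 < n
  /-- number of parameters of each model -/
  dim : M → ℕ
  Θ : (m : M) → Set (EuclideanSpace ℝ (Fin (dim m)))
  measurableSet_Θ : ∀ m, MeasurableSet (Θ m)
  lik : (m : M) → EuclideanSpace ℝ (Fin (dim m)) → ℝ
  lik_nonneg : ∀ m, ∀ θ ∈ Θ m, 0 ≤ lik m θ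
  lik_cont : ∀ m, ContinuousOn (lik m) (Θ m)
  prior : (m : M) → EuclideanSpace ℝ (Fin (dim m)) → ℝ
  prior_pos : ∀ m, ∀ θ ∈ Θ m, 0 < prior m θ
  modelPrior : M → ℝ
  modelPrior_pos : ∀ m, 0 < modelPrior m
  modelPrior_sum : ∑ m, modelPrior m = 1
  avail : Set M
  integrable_of_avail : ∀ m ∈ avail, IntegrableOn (fun θ => lik m θ * prior m θ) (Θ m)
  mle : (m : M) → EuclideanSpace ℝ (Fin (dim m))
  mle_mem : ∀ m, mle m ∈ Θ m
  mle_max : ∀ m, IsMaxOn (lik m) (Θ m) (mle m)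

variable {M : Type*} [Fintype M]

/-- The ambient Euclidean space of the parameters of model `m`. -/
abbrev ModelClass.Par (D : ModelClass M) (m : M) : Type := EuclideanSpace ℝ (Fin (D.dim m))

/-- The marginal likelihood `p(y | m) = ∫ p(y | θ, m) p(θ | m) dθ`. -/
def ModelClass.margLik (D : ModelClass M) (m : M) : ℝ :=
  ∫ θ in D.Θ m, D.lik m θ * D.prior m θ

/-- The approximation of the marginal likelihood with `θ` plugged in for the maximum likelihood
estimate: `log p̃(y | m) = log p(y | θ, m) - (dim m / 2) log n`. -/
def ModelClass.plugIn (D : ModelClass M) (m : M) (θ : D.Par m) : ℝ :=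
  D.lik m θ * (D.n : ℝ) ^ (-(D.dim m : ℝ) / 2)

open Classical in
/-- The value that one evaluation of model `m` at the parameter `θ` returns: the exact marginal
likelihood if it is available, and the plug-in approximation otherwise. -/
def ModelClass.evaluate (D : ModelClass M) (m : M) (θ : D.Par m) : ℝ :=
  if m ∈ D.avail then D.margLik m else D.plugIn m θ

open Classical in
/-- `p_L(y | m)`: the marginal likelihood if it is available, and otherwise its approximation at
the maximum likelihood estimate. -/
def ModelClass.pL (D : ModelClass M) (m : M) : ℝ :=
  if m ∈ D.avail then D.margLik m else D.plugIn m (D.mle m)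

/-- The model probabilities that belong to the marginal likelihoods `e`:
`e(m) p(m) / ∑ e(m') p(m')`. -/
def ModelClass.posterior (D : ModelClass M) (e : M → ℝ) (m : M) : ℝ :=
  e m * D.modelPrior m / ∑ m', e m' * D.modelPrior m'

/-- The target `π(m)`. -/
def ModelClass.target (D : ModelClass M) (m : M) : ℝ := D.posterior D.pL m

/-- A mixture of proposal kernels `q r m m' = q_r(m' | m)` with mixture weights `w r`. The backward
move of a proposal of component `r` is one of component `rev r`. In the ordinary
Metropolis-Hastings algorithm `rev` is the identity. In the mode jumping algorithm, `r` consists of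
the swapped set of indicators and of the outcomes of the forward and the backward local
optimisation, and `rev r` exchanges the two outcomes. Some component of positive weight reaches
every model from every model. -/
structure ProposalMixture (M : Type*) [Fintype M] (R : Type*) where
  w : R → ℝ
  w_nonneg : ∀ r, 0 ≤ w r
  w_sum : HasSum w 1
  q : R → M → M → ℝ
  q_nonneg : ∀ r m m', 0 ≤ q r m m'
  q_sum : ∀ r m, ∑ m', q r m m' = 1
  rev : R → R
  rev_rev : ∀ r, rev (rev r) = r
  w_rev : ∀ r, w (rev r) = w r
  exists_pos : ∃ r, 0 < w r ∧ ∀ m m', 0 < q r m m' ∧ 0 < q (rev r) m m'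

variable {R : Type*}

/-- The Metropolis-Hastings acceptance probability of the move from `m` to `m'` proposed by
component `r`, for the estimates `e` of the marginal likelihoods. -/
def acceptProb (D : ModelClass M) (Q : ProposalMixture M R) (e : M → ℝ) (r : R) (m m' : M) : ℝ :=
  min 1 (e m' * D.modelPrior m' * Q.q (Q.rev r) m' m / (e m * D.modelPrior m * Q.q r m m'))

/-- Probability that component `r` is chosen with some `r`, proposes `m'` from `m`, and the
proposal is accepted. -/
def moveProb (D : ModelClass M) (Q : ProposalMixture M R) (e : M → ℝ) (m m' : M) : ℝ :=
  ∑' r, Q.w r * Q.q r m m' * acceptProb D Q e r m m'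

open Classical in
/-- The Metropolis-Hastings transition matrix for the estimates `e`. The adaptive transition
kernel at time `t` is the one for the estimates at time `t`. -/
def transition (D : ModelClass M) (Q : ProposalMixture M R) (e : M → ℝ) : Matrix M M ℝ :=
  fun m m' =>
    if m' = m then 1 - ∑ k ∈ Finset.univ.erase m, moveProb D Q e m k else moveProb D Q e m m'

/-- The final randomisation: with probability `prand > 0` the parameter returned by the optimiser
is replaced by a draw from a distribution `u m θ` around the returned value `θ`, whose support is
all of the parameter space. -/
structure Randomisation (D : ModelClass M) where
  prand : ℝ
  prand_pos : 0 < prand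
  prand_le_one : prand ≤ 1
  u : (m : M) → Kernel (D.Par m) (D.Par m)
  u_markov : ∀ m, IsMarkovKernel (u m)
  u_compl : ∀ m, ∀ θ ∈ D.Θ m, u m θ (D.Θ m)ᶜ = 0
  u_pos : ∀ m, ∀ θ ∈ D.Θ m, ∀ O : Set (D.Par m), IsOpen O → (O ∩ D.Θ m).Nonempty → 0 < u m θ O

open Classical in
/-- The running best estimates `p^{opt,s}(y | m)`: they start at `ε`, and in step `s + 1`, when
model `y s` is proposed and evaluated at the parameter `th s (y s)`, the estimate of that model is
replaced by the new value if that is larger. -/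
def bestEstimate (D : ModelClass M) (ε : ℝ) (y : ℕ → M) (th : ℕ → (m : M) → D.Par m) :
    ℕ → M → ℝ
  | 0 => fun _ => ε
  | s + 1 => fun m =>
      if m = y s then max (bestEstimate D ε y th s m) (D.evaluate m (th s m))
      else bestEstimate D ε y th s m

/-- A run of the algorithm on the probability space `(Ω, P)`. The objects with index `s` belong to
step `s + 1`, which leads from the state `X s` to the state `X (s + 1)`. The `σ`-algebra `ℱ s` is
the history up to the end of step `s`; within step `s + 1`, `𝒢 s` is the history after the proposal
and the optimisation, and `ℋ s` the history after the randomisation. -/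
structure Run (D : ModelClass M) (Q : ProposalMixture M R) (U : Randomisation D)
    {Ω : Type*} [mΩ : MeasurableSpace Ω] (P : Measure Ω) where
  /-- initial value of all estimates -/
  ε : ℝ
  ε_pos : 0 < ε
  ε_le : ∀ m, ε ≤ D.pL m
  ℱ : Filtration ℕ mΩ
  𝒢 : ℕ → MeasurableSpace Ω
  ℋ : ℕ → MeasurableSpace Ω
  ℱ_le_𝒢 : ∀ s, ℱ s ≤ 𝒢 s
  𝒢_le_ℋ : ∀ s, 𝒢 s ≤ ℋ s
  ℋ_le_ℱ : ∀ s, ℋ s ≤ ℱ (s + 1)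
  /-- the states of the chain, from an arbitrary initial model `X 0` -/
  X : ℕ → Ω → M
  X_meas : ∀ s m, MeasurableSet[ℱ s] {ω | X s ω = m}
  /-- the mixture component that is used -/
  comp : ℕ → Ω → R
  comp_meas : ∀ s r, MeasurableSet[𝒢 s] {ω | comp s ω = r}
  /-- the proposed model -/
  Y : ℕ → Ω → M
  Y_meas : ∀ s m, MeasurableSet[𝒢 s] {ω | Y s ω = m}
  /-- law of the component and the proposal given the past -/
  proposal_law : ∀ s r m,
    P[Set.indicator {ω | comp s ω = r ∧ Y s ω = m} (fun _ => (1 : ℝ)) | ℱ s]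
      =ᵐ[P] fun ω => Q.w r * Q.q r (X s ω) m
  /-- the parameter returned by the optimiser for the proposed model. Only the entry of the
  proposed model is used. It may depend in any way on the past, on the proposal and on
  randomness of its own (subsamples, starting points): any optimiser is allowed, batch stochastic
  gradient descent from arbitrary starting points in particular. -/
  opt : ℕ → Ω → (m : M) → D.Par m
  opt_meas : ∀ s m, Measurable[𝒢 s] (fun ω => opt s ω m)
  opt_mem : ∀ s ω, opt s ω (Y s ω) ∈ D.Θ (Y s ω)
  /-- the event that the returned parameter is randomised -/
  coin : ℕ → Set Ω
  coin_meas : ∀ s, MeasurableSet[ℋ s] (coin s)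
  /-- the final parameter; only the entry of the proposed model is used -/
  par : ℕ → Ω → (m : M) → D.Par m
  par_meas : ∀ s m, Measurable[ℋ s] (fun ω => par s ω m)
  /-- given the past, the proposal and the optimiser's output, the parameter is randomised with
  probability `prand` and is then distributed according to `u` -/
  randomise_law : ∀ s m (A : Set (D.Par m)), MeasurableSet A →
    P[Set.indicator ({ω | Y s ω = m} ∩ coin s ∩ {ω | par s ω m ∈ A}) (fun _ => (1 : ℝ)) | 𝒢 s]
      =ᵐ[P] Set.indicator {ω | Y s ω = m} (fun ω => U.prand * (U.u m (opt s ω m)).real A)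
  par_eq_opt : ∀ s, ∀ ω ∉ coin s, par s ω (Y s ω) = opt s ω (Y s ω)
  /-- the event that the proposal is accepted -/
  acc : ℕ → Set Ω
  acc_meas : ∀ s, MeasurableSet[ℱ (s + 1)] (acc s)
  /-- the proposal is accepted with the Metropolis-Hastings probability for the estimates that
  include the current evaluation -/
  accept_law : ∀ s,
    P[Set.indicator (acc s) (fun _ => (1 : ℝ)) | ℋ s]
      =ᵐ[P] fun ω => acceptProb D Q
        (bestEstimate D ε (fun k => Y k ω) (fun k => par k ω) (s + 1))
        (comp s ω) (X s ω) (Y s ω)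
  X_succ_of_acc : ∀ s, ∀ ω ∈ acc s, X (s + 1) ω = Y s ω
  X_succ_of_not_acc : ∀ s, ∀ ω ∉ acc s, X (s + 1) ω = X s ω

/-- The estimates `p^{opt,t}(y | ·)` of a run. -/
def Run.estimates {D : ModelClass M} {Q : ProposalMixture M R} {U : Randomisation D}
    {Ω : Type*} [MeasurableSpace Ω] {P : Measure Ω} (A : Run D Q U P) (t : ℕ) (ω : Ω) : M → ℝ :=
  bestEstimate D A.ε (fun k => A.Y k ω) (fun k => A.par k ω) t

open Classical in
/-- The frequency-based Monte Carlo estimate `t⁻¹ ∑_{s=1}^t 1(X_s = m)`. -/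
def Run.mcEstimate {D : ModelClass M} {Q : ProposalMixture M R} {U : Randomisation D}
    {Ω : Type*} [MeasurableSpace Ω] {P : Measure Ω} (A : Run D Q U P) (t : ℕ) (ω : Ω) (m : M) : ℝ :=
  (t : ℝ)⁻¹ * ∑ s ∈ Finset.Icc 1 t, if A.X s ω = m then (1 : ℝ) else 0

open Classical in
/-- Geometric ergodicity of every kernel of a family `K e`, `e ∈ T`, of transition matrices on the
finite set `M`, with stationary laws `p e`, in the norm `‖μ‖_V = ∑ |μ(m)| V(m)` of a common function
`V ≥ 1` and with constants that may depend on `e`: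
`‖K_e^k(m, ·) - p_e‖_V ≤ C_e ρ_e^k V(m)`. -/
structure GeometricErgodicity (K : (M → ℝ) → Matrix M M ℝ) (p : (M → ℝ) → M → ℝ)
    (T : Set (M → ℝ)) (V : M → ℝ) (C ρ : (M → ℝ) → ℝ) : Prop where
  one_le_V : ∀ m, 1 ≤ V m
  rho_mem : ∀ e ∈ T, ρ e ∈ Set.Ioo (0 : ℝ) 1
  bound : ∀ e ∈ T, ∀ (k : ℕ) (m : M),
    ∑ m', |(K e ^ k) m m' - p e m'| * V m' ≤ C e * ρ e ^ k * V m

/-- The conditions on a sequence `θ t` of parameters and a limit parameter `θlim` under which the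
stationary laws of `K (θ t)` converge weakly: the ergodicity constants stay bounded along the
sequence, the kernels converge weakly at every point, and the images of every (bounded)
continuous function are equicontinuous. -/
structure KernelConvergence [TopologicalSpace M] (K : (M → ℝ) → Matrix M M ℝ)
    (C ρ : (M → ℝ) → ℝ) (θ : ℕ → M → ℝ) (θlim : M → ℝ) : Prop where
  constants : (∃ B : ℝ, ∀ᶠ t in atTop, C (θ t) ≤ B) ∧ ∃ b < (1 : ℝ), ∀ᶠ t in atTop, ρ (θ t) ≤ b
  weak : ∀ f : M → ℝ, Continuous f → ∀ m,
    Tendsto (fun t => (K (θ t)).mulVec f m) atTop (𝓝 ((K θlim).mulVec f m))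
  equicontinuous : ∀ f : M → ℝ, Continuous f → Equicontinuous fun t => (K (θ t)).mulVec f

end

end SubsamplingMCMC

/-! Identification of the limit. Each running estimate is nondecreasing and almost surely at most
`pL`, hence converges to a possibly random limit `e`. The transition matrix depends continuously on
positive estimates, so the assumed convergence of the adaptive kernels forces `transition D Q e =
transition D Q elim`. An ergodic kernel determines its stationary law as the limit of its powers, so
almost surely `D.posterior e = D.posterior elim`, which is nonrandom. It is therefore enough to
identify it on events of positive probability: for every `η > 0`, with positive probability all
models are evaluated within `η` of `pL` in finitely many steps (`exists_measure_pos_lt_estimates`).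
Letting `η → 0` gives `D.posterior elim = D.posterior D.pL`. Thus `e` is almost surely proportional
to `pL`, and acceptance probabilities see only ratios of estimates, so they converge to those of the
target chain (`ae_tendsto_acceptProb`).

Law of large numbers. The increment of the indicator of a state equals its conditional mean under
the target kernel, plus two bounded martingale differences (randomness of the acceptance and of the
proposal), plus an error that tends to zero. The increments telescope and the martingale parts
average out, so the trajectory is on average invariant under the target kernel
(`ae_tendsto_average_transition_sub`). Since the powers of this kernel converge to `π`, average
invariance forces the frequencies to converge to `π` (`tendsto_frequency_of_average_invariant`). -/

namespace SubsamplingMCMC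

/-! ### Strong law of large numbers for bounded martingale differences -/

section MartingaleDifferences

variable {Ω : Type*} {mΩ : MeasurableSpace Ω} {P : Measure Ω}

lemma ae_abs_sum_range_le {d : ℕ → Ω → ℝ} {c : ℝ} (hb : ∀ s, ∀ᵐ ω ∂P, |d s ω| ≤ c) :
    ∀ᵐ ω ∂P, ∀ t : ℕ, |∑ s ∈ Finset.range t, d s ω| ≤ t * c := by
  filter_upwards [ae_all_iff.2 hb] with ω hω t
  calc |∑ s ∈ Finset.range t, d s ω| ≤ ∑ s ∈ Finset.range t, |d s ω| :=
        Finset.abs_sum_le_sum_abs _ _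
    _ ≤ ∑ _s ∈ Finset.range t, c := Finset.sum_le_sum fun s _ => hω s
    _ = t * c := by simp

variable [IsProbabilityMeasure P]

/-- The second moment of a sum of bounded martingale differences grows at most linearly. -/
lemma integral_sq_sum_le_of_condExp_eq_zero (ℱ : Filtration ℕ mΩ) {d : ℕ → Ω → ℝ} {c : ℝ}
    (hmeas : ∀ s, StronglyMeasurable[ℱ (s + 1)] (d s)) (hb : ∀ s, ∀ᵐ ω ∂P, |d s ω| ≤ c)
    (hc : ∀ s, P[d s | ℱ s] =ᵐ[P] 0) (t : ℕ) :
    Integrable (fun ω => (∑ s ∈ Finset.range t, d s ω) ^ 2) P ∧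
      ∫ ω, (∑ s ∈ Finset.range t, d s ω) ^ 2 ∂P ≤ t * c ^ 2 := by
  have hS (t : ℕ) : StronglyMeasurable[ℱ t] (fun ω => ∑ s ∈ Finset.range t, d s ω) :=
    Finset.stronglyMeasurable_fun_sum _ fun s hs =>
      (hmeas s).mono (ℱ.mono (Finset.mem_range.1 hs))
  have hSi (t : ℕ) : Integrable (fun ω => (∑ s ∈ Finset.range t, d s ω) ^ 2) P := by
    refine Integrable.of_bound (C := (t * c) ^ 2)
      (((hS t).mono (ℱ.le t)).pow 2).aestronglyMeasurable ?_
    filter_upwards [ae_abs_sum_range_le hb] with ω hω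
    rw [Real.norm_eq_abs, abs_pow]
    exact pow_le_pow_left₀ (abs_nonneg _) (hω t) 2
  refine ⟨hSi t, ?_⟩
  induction t with
  | zero => simp
  | succ t ih =>
    have hdm : StronglyMeasurable (d t) := (hmeas t).mono (ℱ.le _)
    have hd : Integrable (d t) P :=
      Integrable.of_bound (C := c) hdm.aestronglyMeasurable (hb t)
    have hd2 : Integrable (fun ω => d t ω ^ 2) P := by
      refine Integrable.of_bound (C := c ^ 2) (hdm.pow 2).aestronglyMeasurable ?_
      filter_upwards [hb t] with ω hω
      rw [Real.norm_eq_abs, abs_pow]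
      exact pow_le_pow_left₀ (abs_nonneg _) hω 2
    have hSd : Integrable (fun ω => (∑ s ∈ Finset.range t, d s ω) * d t ω) P := by
      refine hd.bdd_mul ((hS t).mono (ℱ.le t)).aestronglyMeasurable (c := t * c) ?_
      filter_upwards [ae_abs_sum_range_le hb] with ω hω using hω t
    -- Orthogonality: the sum up to `t` is known at time `t`, so it factors out of the conditional
    -- expectation of the next difference, which is zero.
    have h0 : ∫ ω, (∑ s ∈ Finset.range t, d s ω) * d t ω ∂P = 0 := by
      rw [← integral_condExp (ℱ.le t)]
      refine integral_eq_zero_of_ae ?_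
      filter_upwards [condExp_mul_of_stronglyMeasurable_left (hS t) hSd hd, hc t] with ω h1 h2
      refine h1.trans ?_
      simp [h2]
    have hsq : ∫ ω, d t ω ^ 2 ∂P ≤ c ^ 2 := by
      calc ∫ ω, d t ω ^ 2 ∂P ≤ ∫ _ω, c ^ 2 ∂P := by
            refine integral_mono_ae hd2 (integrable_const _) ?_
            filter_upwards [hb t] with ω hω
            rw [← sq_abs]
            exact pow_le_pow_left₀ (abs_nonneg _) hω 2
        _ = c ^ 2 := by simp
    have hexp : (fun ω => (∑ s ∈ Finset.range (t + 1), d s ω) ^ 2) = fun ω =>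
        ((∑ s ∈ Finset.range t, d s ω) ^ 2 + 2 * ((∑ s ∈ Finset.range t, d s ω) * d t ω))
          + d t ω ^ 2 := by
      ext ω
      rw [Finset.sum_range_succ]
      ring
    have hsum : ∫ ω, ((∑ s ∈ Finset.range t, d s ω) ^ 2
        + 2 * ((∑ s ∈ Finset.range t, d s ω) * d t ω)) ∂P
        = ∫ ω, (∑ s ∈ Finset.range t, d s ω) ^ 2 ∂P := by
      rw [integral_add (hSi t) (hSd.const_mul 2), integral_const_mul, h0, mul_zero, add_zero]
    have hint : Integrable (fun ω => (∑ s ∈ Finset.range t, d s ω) ^ 2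
        + 2 * ((∑ s ∈ Finset.range t, d s ω) * d t ω)) P := (hSi t).add (hSd.const_mul 2)
    rw [hexp, integral_add hint hd2, hsum]
    push_cast
    linarith

/-- Strong law of large numbers for bounded martingale differences. -/
theorem ae_tendsto_average_of_condExp_eq_zero (ℱ : Filtration ℕ mΩ) {d : ℕ → Ω → ℝ} {c : ℝ}
    (hmeas : ∀ s, StronglyMeasurable[ℱ (s + 1)] (d s)) (hb : ∀ s, ∀ᵐ ω ∂P, |d s ω| ≤ c)
    (hc : ∀ s, P[d s | ℱ s] =ᵐ[P] 0) :
    ∀ᵐ ω ∂P, Tendsto (fun t : ℕ => (∑ s ∈ Finset.range t, d s ω) / t) atTop (𝓝 0) := by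
  set S : ℕ → Ω → ℝ := fun t ω => ∑ s ∈ Finset.range t, d s ω with hSdef
  have hSm (t : ℕ) : Measurable (S t) :=
    Finset.measurable_fun_sum _ fun s _ => ((hmeas s).mono (ℱ.le _)).measurable
  -- Along the squares the second moments of the averages are at most `c ^ 2 / (k + 1) ^ 2`, which
  -- is summable; hence the averages tend to zero almost surely along this subsequence.
  have hfin : ∫⁻ ω, ∑' k : ℕ, ENNReal.ofReal ((S ((k + 1) ^ 2) ω / ((k + 1) ^ 2 : ℕ)) ^ 2) ∂P
      ≠ ⊤ := by
    rw [lintegral_tsum fun k => (((hSm _).div_const _).pow_const 2).ennreal_ofReal.aemeasurable]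
    have hk (k : ℕ) : ∫⁻ ω, ENNReal.ofReal ((S ((k + 1) ^ 2) ω / ((k + 1) ^ 2 : ℕ)) ^ 2) ∂P
        ≤ ENNReal.ofReal (c ^ 2 * (1 / ((k + 1 : ℕ) : ℝ) ^ 2)) := by
      obtain ⟨hi, hle⟩ := integral_sq_sum_le_of_condExp_eq_zero ℱ hmeas hb hc ((k + 1) ^ 2)
      have heq : (fun ω => (S ((k + 1) ^ 2) ω / ((k + 1) ^ 2 : ℕ)) ^ 2)
          = fun ω => (S ((k + 1) ^ 2) ω) ^ 2 / (((k + 1) ^ 2 : ℕ) : ℝ) ^ 2 := by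
        ext ω; rw [div_pow]
      rw [← ofReal_integral_eq_lintegral_ofReal (by rw [heq]; exact hi.div_const _)
        (ae_of_all _ fun ω => sq_nonneg _), heq, integral_div]
      refine ENNReal.ofReal_le_ofReal ?_
      rw [div_le_iff₀ (by positivity)]
      refine hle.trans (le_of_eq ?_)
      push_cast
      field_simp
    refine ne_top_of_le_ne_top ?_ (ENNReal.tsum_le_tsum hk)
    refine Summable.tsum_ofReal_ne_top (Summable.mul_left _ ?_)
    exact (summable_nat_add_iff 1).2 (Real.summable_one_div_nat_pow.2 one_lt_two)
  have hae := ae_lt_top (Measurable.tsum fun k =>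
    (((hSm ((k + 1) ^ 2)).div_const (((k + 1) ^ 2 : ℕ) : ℝ)).pow_const 2).ennreal_ofReal) hfin
  filter_upwards [hae, ae_all_iff.2 hb] with ω h1 h2
  have h3 := ENNReal.tendsto_atTop_zero_of_tsum_ne_top h1.ne
  have h4 : Tendsto (fun k : ℕ => S ((k + 1) ^ 2) ω / ((k + 1) ^ 2 : ℕ)) atTop (𝓝 0) := by
    have h5 := (ENNReal.tendsto_toReal ENNReal.zero_ne_top).comp h3
    have h6 : Tendsto (fun k : ℕ => (S ((k + 1) ^ 2) ω / ((k + 1) ^ 2 : ℕ)) ^ 2) atTop (𝓝 0) := by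
      refine h5.congr fun k => ?_
      exact ENNReal.toReal_ofReal (sq_nonneg _)
    have h7 := h6.sqrt
    simp only [Real.sqrt_zero, Real.sqrt_sq_eq_abs] at h7
    exact (tendsto_zero_iff_abs_tendsto_zero _).2 h7
  -- The drift `c * t` makes the sums monotone, so the gaps between squares can be filled:
  -- consecutive squares have ratio tending to 1. The limit `c` of the shifted averages is
  -- subtracted at the end.
  have hmono : Monotone fun t : ℕ => S t ω + c * t := by
    refine monotone_nat_of_le_succ fun t => ?_
    have := (abs_le.1 (h2 t)).1
    simp only [hSdef, Finset.sum_range_succ]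
    push_cast
    linarith
  have h5 := tendsto_div_of_monotone_of_exists_subseq_tendsto_div _ c hmono fun a ha => by
    refine ⟨fun k => (k + 1) ^ 2, ?_, ?_, ?_⟩
    · have h7 : Tendsto (fun k : ℕ => (1 + 1 / ((k : ℝ) + 1)) ^ 2) atTop (𝓝 ((1 + 0) ^ 2)) :=
        (tendsto_one_div_add_atTop_nhds_zero_nat.const_add 1).pow 2
      rw [add_zero, one_pow] at h7
      filter_upwards [h7.eventually_lt_const ha] with k hk
      have : (((k + 1 + 1) ^ 2 : ℕ) : ℝ)
          = (1 + 1 / ((k : ℝ) + 1)) ^ 2 * (((k + 1) ^ 2 : ℕ) : ℝ) := by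
        push_cast
        field_simp
      rw [this]
      exact mul_le_mul_of_nonneg_right hk.le (by positivity)
    · exact (tendsto_pow_atTop two_ne_zero).comp (tendsto_add_atTop_nat 1)
    · have h8 := h4.add_const c
      rw [zero_add] at h8
      refine h8.congr fun k => ?_
      have : (((k + 1) ^ 2 : ℕ) : ℝ) ≠ 0 := by positivity
      field_simp
  have h9 := h5.sub_const c
  rw [sub_self] at h9
  refine h9.congr' ?_
  filter_upwards [eventually_gt_atTop 0] with t ht
  have : (t : ℝ) ≠ 0 := by positivity
  field_simp
  ring

end MartingaleDifferences

/-! ### Average invariance of a trajectory, and a bound for the acceptance function -/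

section Deterministic

variable {M : Type*} [Fintype M]

open Classical in
/-- If a sequence of states is, on average, invariant under a transition matrix whose powers
converge to `p`, then its empirical frequencies converge to `p`. -/
lemma tendsto_frequency_of_average_invariant (K : Matrix M M ℝ) (p : M → ℝ) (x : ℕ → M)
    (hK : ∀ m m', Tendsto (fun k : ℕ => (K ^ k) m m') atTop (𝓝 (p m')))
    (h : ∀ m', Tendsto (fun t : ℕ =>
      (∑ s ∈ Finset.range t, (K (x s) m' - if x s = m' then 1 else 0)) / t) atTop (𝓝 0))
    (m : M) :
    Tendsto (fun t : ℕ => (t : ℝ)⁻¹ * ∑ s ∈ Finset.Icc 1 t, if x s = m then (1 : ℝ) else 0)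
      atTop (𝓝 (p m)) := by
  -- Average invariance passes to powers through `K ^ (k + 1) - 1 = (K - 1) * K ^ k + (K ^ k - 1)`,
  -- the matrix product being a finite sum over intermediate states.
  have hpow (k : ℕ) : Tendsto (fun t : ℕ =>
      (∑ s ∈ Finset.range t, ((K ^ k) (x s) m - if x s = m then 1 else 0)) / t)
      atTop (𝓝 0) := by
    induction k with
    | zero => simp [Matrix.one_apply]
    | succ k ih =>
      have h1 : Tendsto (fun t : ℕ => ∑ j,
          (∑ s ∈ Finset.range t, (K (x s) j - if x s = j then 1 else 0)) / t * (K ^ k) j m)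
          atTop (𝓝 (∑ j : M, 0 * (K ^ k) j m)) :=
        tendsto_finsetSum _ fun j _ => (h j).mul_const _
      have h2 := h1.add ih
      simp only [zero_mul, Finset.sum_const_zero, add_zero] at h2
      refine h2.congr fun t => ?_
      have h3 (y : M) : (K ^ (k + 1)) y m
          = ∑ j, (K y j - if y = j then 1 else 0) * (K ^ k) j m + (K ^ k) y m := by
        rw [pow_succ', Matrix.mul_apply]
        simp [sub_mul, Finset.sum_sub_distrib]
      simp_rw [h3]
      rw [Finset.sum_congr rfl fun s _ => add_sub_assoc _ _ _, Finset.sum_add_distrib, add_div,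
        Finset.sum_comm]
      congr 1
      rw [Finset.sum_div]
      refine Finset.sum_congr rfl fun j _ => ?_
      rw [← Finset.sum_mul]
      ring
  have hfreq : Tendsto (fun t : ℕ =>
      (∑ s ∈ Finset.range t, if x s = m then (1 : ℝ) else 0) / t) atTop (𝓝 (p m)) := by
    rw [Metric.tendsto_atTop']
    intro η hη
    -- As there are finitely many states, a single power is close to `p m` from every starting
    -- state, whatever the trajectory does.
    have hu : ∀ᶠ k : ℕ in atTop, ∀ y, |(K ^ k) y m - p m| < η / 2 := by
      refine eventually_all.2 fun y => ?_
      exact (Metric.tendsto_nhds.1 (hK y m)) (η / 2) (half_pos hη)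
    obtain ⟨k, hk⟩ := hu.exists
    obtain ⟨N, hN⟩ := Metric.tendsto_atTop.1 (hpow k) (η / 2) (half_pos hη)
    refine ⟨N, fun t ht => ?_⟩
    have ht0 : (0 : ℝ) < t := by exact_mod_cast (Nat.zero_le N).trans_lt ht
    have h1 := hN t ht.le
    rw [Real.dist_eq, sub_zero, Finset.sum_sub_distrib, sub_div] at h1
    have h2 : |(∑ s ∈ Finset.range t, (K ^ k) (x s) m) / t - p m| ≤ η / 2 := by
      have h3 : (∑ s ∈ Finset.range t, (K ^ k) (x s) m) / t - p m
          = (∑ s ∈ Finset.range t, ((K ^ k) (x s) m - p m)) / t := by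
        rw [Finset.sum_sub_distrib]
        simp
        field_simp
      rw [h3, abs_div, abs_of_pos ht0, div_le_iff₀ ht0]
      calc _ ≤ ∑ s ∈ Finset.range t, |(K ^ k) (x s) m - p m| := Finset.abs_sum_le_sum_abs _ _
        _ ≤ ∑ _s ∈ Finset.range t, η / 2 := Finset.sum_le_sum fun s _ => (hk _).le
        _ = η / 2 * t := by simp; ring
    rw [Real.dist_eq, abs_sub_lt_iff]
    have h4 := abs_sub_lt_iff.1 h1
    have h5 := abs_sub_le_iff.1 h2
    constructor <;> linarith [h4.1, h4.2, h5.1, h5.2]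
  -- Passing from times `0, …, t - 1` to times `1, …, t` changes only two boundary terms.
  have hend : Tendsto (fun t : ℕ => ((if x t = m then (1 : ℝ) else 0)
      - if x 0 = m then (1 : ℝ) else 0) / t) atTop (𝓝 0) := by
    refine squeeze_zero_norm (a := fun t : ℕ => 1 / (t : ℝ)) (fun t => ?_)
      tendsto_one_div_atTop_nhds_zero_nat
    rw [norm_div, Real.norm_natCast]
    gcongr
    split_ifs <;> simp
  have hsum := hfreq.add hend
  rw [add_zero] at hsum
  refine hsum.congr fun t => ?_
  rw [← add_div, div_eq_inv_mul]
  congr 1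
  have h1 := Finset.sum_range_succ (fun s => if x s = m then (1 : ℝ) else 0) t
  have h2 := Finset.sum_range_succ' (fun s => if x s = m then (1 : ℝ) else 0) t
  have h3 : ∑ s ∈ Finset.Icc 1 t, (if x s = m then (1 : ℝ) else 0)
      = ∑ s ∈ Finset.range t, if x (s + 1) = m then (1 : ℝ) else 0 := by
    rw [Finset.range_eq_Ico, Finset.sum_Ico_add' (fun s => if x s = m then (1 : ℝ) else 0) 0 t 1]
    rfl
  rw [h3]
  linarith

/-- The Metropolis-Hastings acceptance function is Lipschitz in the logarithm of the ratio. -/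
lemma abs_min_one_sub_min_one_le {a b c : ℝ} (ha : 0 < a) (hb : 0 < b) (hc : 0 ≤ c) :
    |min 1 (a * c) - min 1 (b * c)| ≤ |a / b - 1| := by
  -- Only the relative change `a / b` enters the bound. Its independence of `c` later gives
  -- uniformity over the countably many mixture components.
  have hab : a * c = a / b * (b * c) := by field_simp
  have hr : 0 < a / b := div_pos ha hb
  have hbc : 0 ≤ b * c := by positivity
  rw [hab]
  set r := a / b
  set z := b * c
  rcases le_total z 1 with hz | hz
  · rw [min_eq_right hz]
    rcases le_total (r * z) 1 with h | h
    · rw [min_eq_right h, show r * z - z = (r - 1) * z by ring, abs_mul, abs_of_nonneg hbc]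
      exact mul_le_of_le_one_right (abs_nonneg _) hz
    · rw [min_eq_left h, abs_of_nonneg (by linarith)]
      refine le_trans ?_ (le_abs_self _)
      have h1 : 1 ≤ r := by nlinarith
      nlinarith
  · rw [min_eq_left hz]
    rcases le_total (r * z) 1 with h | h
    · rw [min_eq_right h, abs_sub_comm, abs_of_nonneg (by linarith), abs_sub_comm]
      refine le_trans ?_ (le_abs_self _)
      nlinarith
    · rw [min_eq_left h]
      simp

end Deterministic

/-! ### Acceptance probabilities, transition matrices and stationary laws as functions of the
estimates -/

section Kernels

variable {M : Type*} [Fintype M] {R : Type*} (D : ModelClass M) (Q : ProposalMixture M R)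

lemma ModelClass.nonempty {M : Type*} [Fintype M] (D : ModelClass M) : Nonempty M := by
  by_contra h
  rw [not_nonempty_iff] at h
  have := D.modelPrior_sum
  simp at this

/-- Separates the ratio of the estimates from a nonnegative factor free of `e`. It also holds when
the forward proposal probability vanishes, both sides then being zero by the convention for division
by zero. -/
lemma acceptProb_eq (e : M → ℝ) (r : R) (m m' : M) :
    acceptProb D Q e r m m' = min 1 (e m' / e m *
      (D.modelPrior m' * Q.q (Q.rev r) m' m / (D.modelPrior m * Q.q r m m'))) := by
  rw [acceptProb, div_mul_div_comm, mul_assoc, mul_assoc]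

lemma acceptProb_le_one (e : M → ℝ) (r : R) (m m' : M) : acceptProb D Q e r m m' ≤ 1 :=
  min_le_left _ _

lemma priorRatio_nonneg (r : R) (m m' : M) :
    0 ≤ D.modelPrior m' * Q.q (Q.rev r) m' m / (D.modelPrior m * Q.q r m m') :=
  div_nonneg (mul_nonneg (D.modelPrior_pos _).le (Q.q_nonneg _ _ _))
    (mul_nonneg (D.modelPrior_pos _).le (Q.q_nonneg _ _ _))

lemma acceptProb_nonneg {e : M → ℝ} (he : ∀ m, 0 < e m) (r : R) (m m' : M) :
    0 ≤ acceptProb D Q e r m m' := by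
  rw [acceptProb_eq]
  exact le_min zero_le_one
    (mul_nonneg (div_nonneg (he _).le (he _).le) (priorRatio_nonneg D Q r m m'))

lemma abs_acceptProb_le_one {e : M → ℝ} (he : ∀ m, 0 < e m) (r : R) (m m' : M) :
    |acceptProb D Q e r m m'| ≤ 1 := by
  rw [abs_of_nonneg (acceptProb_nonneg D Q he r m m')]
  exact acceptProb_le_one D Q e r m m'

/-- The acceptance probability depends on the estimates continuously, uniformly in the mixture
component. -/
lemma abs_acceptProb_sub_le {e e' : M → ℝ} (he : ∀ m, 0 < e m) (he' : ∀ m, 0 < e' m)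
    (r : R) (m m' : M) :
    |acceptProb D Q e r m m' - acceptProb D Q e' r m m'|
      ≤ |e m' / e m / (e' m' / e' m) - 1| := by
  rw [acceptProb_eq, acceptProb_eq]
  exact abs_min_one_sub_min_one_le (div_pos (he _) (he _)) (div_pos (he' _) (he' _))
    (priorRatio_nonneg D Q r m m')

lemma ProposalMixture.q_le_one (r : R) (m m' : M) : Q.q r m m' ≤ 1 := by
  rw [← Q.q_sum r m]
  exact Finset.single_le_sum (fun y _ => Q.q_nonneg r m y) (Finset.mem_univ m')

/-- Dominated convergence over the components, with the weights `Q.w` as summable bound. -/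
lemma tendsto_moveProb {e : ℕ → M → ℝ} {e' : M → ℝ} (he : ∀ t m, 0 < e t m)
    (he' : ∀ m, 0 < e' m) (h : ∀ m, Tendsto (fun t => e t m) atTop (𝓝 (e' m))) (m m' : M) :
    Tendsto (fun t => moveProb D Q (e t) m m') atTop (𝓝 (moveProb D Q e' m m')) := by
  refine tendsto_tsum_of_dominated_convergence Q.w_sum.summable (fun r => ?_)
    (Eventually.of_forall fun t r => ?_)
  · simp_rw [acceptProb_eq]
    exact (tendsto_const_nhds.min (((h m').div (h m) (he' m).ne').mul_const _)).const_mul _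
  · rw [Real.norm_eq_abs, abs_mul, abs_of_nonneg (mul_nonneg (Q.w_nonneg r) (Q.q_nonneg r m m')),
      mul_assoc]
    exact mul_le_of_le_one_right (Q.w_nonneg r) (mul_le_one₀ (Q.q_le_one r m m') (abs_nonneg _)
      (abs_acceptProb_le_one D Q (he t) r m m'))

lemma tendsto_transition {e : ℕ → M → ℝ} {e' : M → ℝ} (he : ∀ t m, 0 < e t m)
    (he' : ∀ m, 0 < e' m) (h : ∀ m, Tendsto (fun t => e t m) atTop (𝓝 (e' m))) (m m' : M) :
    Tendsto (fun t => transition D Q (e t) m m') atTop (𝓝 (transition D Q e' m m')) := by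
  unfold transition
  split_ifs
  · exact tendsto_const_nhds.sub
      (tendsto_finsetSum _ fun k _ => tendsto_moveProb D Q he he' h m k)
  · exact tendsto_moveProb D Q he he' h m m'

-- The mean change of the indicator of `m` in one step from `x`. Accepted self-proposals do not
-- matter, because the difference of indicators vanishes at `y = x`; this matches the diagonal of
-- `transition`, defined as the complement of the off-diagonal row sum.
open Classical in
lemma sum_moveProb_mul_indicator_sub (e : M → ℝ) (x m : M) :
    ∑ y, moveProb D Q e x y * ((if y = m then (1 : ℝ) else 0) - if x = m then 1 else 0)
      = transition D Q e x m - if x = m then 1 else 0 := by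
  unfold transition
  rcases eq_or_ne x m with rfl | h
  · rw [if_pos rfl, if_pos rfl, ← Finset.sum_erase_add _ _ (Finset.mem_univ x), if_pos rfl,
      sub_self, mul_zero, add_zero, sub_sub_cancel_left, ← Finset.sum_neg_distrib]
    refine Finset.sum_congr rfl fun y hy => ?_
    rw [if_neg (Finset.ne_of_mem_erase hy)]
    ring
  · simp [h, h.symm]

-- Because `V ≥ 1`, the weighted norm dominates each single entry.
open Classical in
lemma GeometricErgodicity.tendsto_pow {K : (M → ℝ) → Matrix M M ℝ} {p : (M → ℝ) → M → ℝ}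
    {T : Set (M → ℝ)} {V : M → ℝ} {C ρ : (M → ℝ) → ℝ} (h : GeometricErgodicity K p T V C ρ)
    {e : M → ℝ} (he : e ∈ T) (m m' : M) :
    Tendsto (fun k : ℕ => (K e ^ k) m m') atTop (𝓝 (p e m')) := by
  have h1 : Tendsto (fun k : ℕ => C e * ρ e ^ k * V m) atTop (𝓝 (C e * 0 * V m)) :=
    ((tendsto_pow_atTop_nhds_zero_of_lt_one (h.rho_mem e he).1.le (h.rho_mem e he).2).const_mul
      _).mul_const _
  rw [mul_zero, zero_mul] at h1
  rw [tendsto_iff_dist_tendsto_zero]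
  refine squeeze_zero (fun _ => dist_nonneg) (fun k => ?_) h1
  rw [Real.dist_eq]
  calc |(K e ^ k) m m' - p e m'| ≤ |(K e ^ k) m m' - p e m'| * V m' :=
        le_mul_of_one_le_right (abs_nonneg _) (h.one_le_V m')
    _ ≤ ∑ y, |(K e ^ k) m y - p e y| * V y :=
        Finset.single_le_sum (f := fun y => |(K e ^ k) m y - p e y| * V y)
          (fun y _ => mul_nonneg (abs_nonneg _) (zero_le_one.trans (h.one_le_V y)))
          (Finset.mem_univ m')
    _ ≤ _ := h.bound e he k m

/-- Parameters with the same ergodic kernel have the same stationary law. -/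
lemma GeometricErgodicity.stationary_eq {K : (M → ℝ) → Matrix M M ℝ} {p : (M → ℝ) → M → ℝ}
    {T : Set (M → ℝ)} {V : M → ℝ} {C ρ : (M → ℝ) → ℝ} (h : GeometricErgodicity K p T V C ρ)
    {e e' : M → ℝ} (he : e ∈ T) (he' : e' ∈ T) (hK : K e = K e') : p e = p e' := by
  ext m
  have h1 := h.tendsto_pow he m m
  rw [hK] at h1
  exact tendsto_nhds_unique h1 (h.tendsto_pow he' m m)

lemma ModelClass.sum_mul_modelPrior_pos {e : M → ℝ} (he : ∀ m, 0 < e m) :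
    0 < ∑ m, e m * D.modelPrior m :=
  haveI := D.nonempty
  Finset.sum_pos (fun m _ => mul_pos (he m) (D.modelPrior_pos m)) Finset.univ_nonempty

lemma ModelClass.tendsto_posterior {e : ℕ → M → ℝ} {e' : M → ℝ} (he' : ∀ m, 0 < e' m)
    (h : ∀ m, Tendsto (fun t => e t m) atTop (𝓝 (e' m))) (m : M) :
    Tendsto (fun t => D.posterior (e t) m) atTop (𝓝 (D.posterior e' m)) :=
  ((h m).mul_const _).div (tendsto_finsetSum _ fun k _ => (h k).mul_const _)
    (D.sum_mul_modelPrior_pos he').ne'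

/-- The posterior determines the ratios of the estimates. -/
lemma ModelClass.div_eq_div_of_posterior_eq {e e' : M → ℝ} (he : ∀ m, 0 < e m)
    (he' : ∀ m, 0 < e' m) (h : D.posterior e = D.posterior e') (m m' : M) :
    e m' / e m = e' m' / e' m := by
  have h1 := congrFun h m
  have h2 := congrFun h m'
  have hs := D.sum_mul_modelPrior_pos he
  have hs' := D.sum_mul_modelPrior_pos he'
  have hm := D.modelPrior_pos m
  have hm' := D.modelPrior_pos m'
  unfold ModelClass.posterior at h1 h2
  set S := ∑ m, e m * D.modelPrior m
  set S' := ∑ m, e' m * D.modelPrior m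
  rw [div_eq_div_iff hs.ne' hs'.ne'] at h1 h2
  have h3 : e m * S' = e' m * S := mul_right_cancel₀ hm.ne' (by linarith)
  have h4 : e m' * S' = e' m' * S := mul_right_cancel₀ hm'.ne' (by linarith)
  rw [div_eq_div_iff (he m).ne' (he' m).ne']
  refine mul_right_cancel₀ hs.ne' ?_
  linear_combination (-e m') * h3 + e m * h4

lemma ModelClass.evaluate_mle (m : M) : D.evaluate m (D.mle m) = D.pL m := rfl

lemma ModelClass.evaluate_le_pL {m : M} {θ : D.Par m} (h : θ ∈ D.Θ m) :
    D.evaluate m θ ≤ D.pL m := by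
  unfold ModelClass.evaluate ModelClass.pL
  split_ifs
  · exact le_rfl
  · exact mul_le_mul_of_nonneg_right (D.mle_max m h) (Real.rpow_nonneg (Nat.cast_nonneg _) _)

lemma ModelClass.continuousOn_evaluate (m : M) : ContinuousOn (D.evaluate m) (D.Θ m) := by
  unfold ModelClass.evaluate ModelClass.plugIn
  split_ifs
  · exact continuousOn_const
  · exact (D.lik_cont m).mul continuousOn_const

/-- Parameters close to the maximum likelihood estimate give values close to the maximum. -/
lemma ModelClass.exists_isOpen_lt_evaluate (m : M) {η : ℝ} (hη : 0 < η) :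
    ∃ O : Set (D.Par m), IsOpen O ∧ (O ∩ D.Θ m).Nonempty ∧
      ∀ θ ∈ O ∩ D.Θ m, D.pL m - η < D.evaluate m θ := by
  have h := (D.continuousOn_evaluate m _ (D.mle_mem m)).eventually_const_lt
    (u := D.pL m - η) (by rw [D.evaluate_mle]; linarith)
  obtain ⟨O, hO, hmem, hsub⟩ := mem_nhdsWithin.1 h
  exact ⟨O, hO, ⟨_, hmem, D.mle_mem m⟩, fun θ hθ => hsub hθ⟩

/-! ### Monotonicity and bounds of the running estimates -/

section Estimates

variable (ε : ℝ) (y : ℕ → M) (th : ℕ → (m : M) → D.Par m)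

lemma monotone_bestEstimate (m : M) : Monotone fun t => bestEstimate D ε y th t m := by
  refine monotone_nat_of_le_succ fun t => ?_
  simp only [bestEstimate]
  split_ifs
  · exact le_max_left _ _
  · exact le_rfl

lemma le_bestEstimate (t : ℕ) (m : M) : ε ≤ bestEstimate D ε y th t m :=
  monotone_bestEstimate D ε y th m (Nat.zero_le t)

lemma evaluate_le_bestEstimate (t : ℕ) :
    D.evaluate (y t) (th t (y t)) ≤ bestEstimate D ε y th (t + 1) (y t) := by
  simp only [bestEstimate, if_true]
  exact le_max_right _ _

lemma bestEstimate_le_pL (hε : ∀ m, ε ≤ D.pL m) (hth : ∀ s, th s (y s) ∈ D.Θ (y s)) (t : ℕ)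
    (m : M) : bestEstimate D ε y th t m ≤ D.pL m := by
  induction t with
  | zero => exact hε m
  | succ t ih =>
    simp only [bestEstimate]
    split_ifs with h
    · subst h
      exact max_le ih (D.evaluate_le_pL (hth t))
    · exact ih

end Estimates

end Kernels

/-! ### The limit of the estimates along a run -/

namespace Run

variable {M : Type*} [Fintype M] {R : Type*} {D : ModelClass M} {Q : ProposalMixture M R}
  {U : Randomisation D} {Ω : Type*} [mΩ : MeasurableSpace Ω] {P : Measure Ω} (A : Run D Q U P)

lemma ℋ_le (s : ℕ) : A.ℋ s ≤ mΩ := (A.ℋ_le_ℱ s).trans (A.ℱ.le _)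

lemma 𝒢_le (s : ℕ) : A.𝒢 s ≤ mΩ := (A.𝒢_le_ℋ s).trans (A.ℋ_le s)

lemma pL_pos (A : Run D Q U P) (m : M) : 0 < D.pL m := A.ε_pos.trans_le (A.ε_le m)

lemma estimates_pos (t : ℕ) (ω : Ω) (m : M) : 0 < A.estimates t ω m :=
  A.ε_pos.trans_le (le_bestEstimate D _ _ _ t m)

lemma integrable_randomise (s : ℕ) (m : M) {S : Set (D.Par m)} (hS : MeasurableSet S) :
    Integrable (Set.indicator {ω | A.Y s ω = m}
      (fun ω => U.prand * (U.u m (A.opt s ω m)).real S)) P :=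
  integrable_condExp.congr (A.randomise_law s m S hS)

variable [IsProbabilityMeasure P]

/-- Probability of the joint event that a given component is used and a given model proposed. -/
lemma measureReal_inter_proposal (s : ℕ) (r : R) (m : M) {B : Set Ω}
    (hB : MeasurableSet[A.ℱ s] B) :
    P.real (B ∩ {ω | A.comp s ω = r ∧ A.Y s ω = m})
      = ∫ ω in B, Q.w r * Q.q r (A.X s ω) m ∂P := by
  have hE : MeasurableSet {ω | A.comp s ω = r ∧ A.Y s ω = m} :=
    A.𝒢_le s _ ((A.comp_meas s r).inter (A.Y_meas s m))
  rw [← integral_congr_ae (ae_restrict_of_ae (A.proposal_law s r m)),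
    setIntegral_condExp (A.ℱ.le s) ((integrable_const _).indicator hE) hB,
    setIntegral_indicator hE, setIntegral_const, smul_eq_mul, mul_one]

lemma measureReal_inter_randomise (s : ℕ) (m : M) {S : Set (D.Par m)} (hS : MeasurableSet S)
    {B : Set Ω} (hB : MeasurableSet[A.𝒢 s] B) :
    P.real (B ∩ ({ω | A.Y s ω = m} ∩ A.coin s ∩ {ω | A.par s ω m ∈ S}))
      = ∫ ω in B, Set.indicator {ω | A.Y s ω = m}
          (fun ω => U.prand * (U.u m (A.opt s ω m)).real S) ω ∂P := by
  have hE : MeasurableSet ({ω | A.Y s ω = m} ∩ A.coin s ∩ {ω | A.par s ω m ∈ S}) :=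
    A.ℋ_le s _ (((A.𝒢_le_ℋ s _ (A.Y_meas s m)).inter (A.coin_meas s)).inter
      (A.par_meas s m hS))
  rw [← integral_congr_ae (ae_restrict_of_ae (A.randomise_law s m S hS)),
    setIntegral_condExp (A.𝒢_le s) ((integrable_const _).indicator hE) hB,
    setIntegral_indicator hE, setIntegral_const, smul_eq_mul, mul_one]

/-- All evaluated parameters lie in the parameter space. -/
lemma ae_par_mem : ∀ᵐ ω ∂P, ∀ s, A.par s ω (A.Y s ω) ∈ D.Θ (A.Y s ω) := by
  have h (s : ℕ) (m : M) : ∀ᵐ ω ∂P,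
      ω ∉ {ω | A.Y s ω = m} ∩ A.coin s ∩ {ω | A.par s ω m ∈ (D.Θ m)ᶜ} := by
    have h1 := A.measureReal_inter_randomise s m (D.measurableSet_Θ m).compl
      (B := Set.univ) MeasurableSet.univ
    have h2 : Set.indicator {ω | A.Y s ω = m}
        (fun ω => U.prand * (U.u m (A.opt s ω m)).real (D.Θ m)ᶜ) = 0 := by
      ext ω
      refine Set.indicator_apply_eq_zero.2 fun hω => ?_
      have hω : A.Y s ω = m := hω
      have h3 := U.u_compl m (A.opt s ω m) (by subst hω; exact A.opt_mem s ω)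
      simp [measureReal_def, h3]
    rw [h2, Set.univ_inter] at h1
    simp only [Pi.zero_apply, integral_zero] at h1
    exact measure_eq_zero_iff_ae_notMem.1 ((measureReal_eq_zero_iff).1 h1)
  filter_upwards [ae_all_iff.2 fun s => ae_all_iff.2 (h s)] with ω hω s
  by_contra hn
  by_cases hc : ω ∈ A.coin s
  · exact hω s (A.Y s ω) ⟨⟨rfl, hc⟩, hn⟩
  · rw [A.par_eq_opt s ω hc] at hn
    exact hn (A.opt_mem s ω)

/-- Whatever the past, the next evaluation is, with positive probability, one of a given model at a
parameter in a given open set. -/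
lemma measureReal_inter_pos (s : ℕ) (m : M) {O : Set (D.Par m)} (hO : IsOpen O)
    (hne : (O ∩ D.Θ m).Nonempty) {B : Set Ω} (hB : MeasurableSet[A.ℱ s] B)
    (hpos : 0 < P.real B) :
    0 < P.real (B ∩ {ω | A.Y s ω = m ∧ A.par s ω m ∈ O}) := by
  obtain ⟨r, hw, hq⟩ := Q.exists_pos
  have hmB : MeasurableSet B := A.ℱ.le s _ hB
  have hBP : 0 < P B := (ENNReal.toReal_pos_iff.1 hpos).1
  -- Two successive conditionings: given the past, the everywhere positive component `r` proposes
  -- `m` with positive probability; given that, the randomisation reaches `O` with positive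
  -- probability wherever the optimiser stopped.
  set F := B ∩ {ω | A.comp s ω = r ∧ A.Y s ω = m} with hF
  have hFm : MeasurableSet[A.𝒢 s] F :=
    (A.ℱ_le_𝒢 s _ hB).inter ((A.comp_meas s r).inter (A.Y_meas s m))
  have hFpos : 0 < P F := by
    have hi : Integrable (fun ω => Q.w r * Q.q r (A.X s ω) m) P :=
      integrable_condExp.congr (A.proposal_law s r m)
    have h1 : 0 < P.real F := by
      rw [hF, A.measureReal_inter_proposal s r m hB, setIntegral_pos_iff_support_of_nonneg_ae
        (ae_of_all _ fun ω => mul_nonneg hw.le (Q.q_nonneg _ _ _)) hi.integrableOn]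
      have : Function.support (fun ω => Q.w r * Q.q r (A.X s ω) m) = Set.univ :=
        Set.eq_univ_of_forall fun ω => (mul_pos hw (hq _ _).1).ne'
      rwa [this, Set.univ_inter]
    exact (ENNReal.toReal_pos_iff.1 h1).1
  have h2 : 0 < P.real (F ∩ ({ω | A.Y s ω = m} ∩ A.coin s ∩ {ω | A.par s ω m ∈ O})) := by
    have hnn : ∀ ω, 0 ≤ Set.indicator {ω | A.Y s ω = m}
        (fun ω => U.prand * (U.u m (A.opt s ω m)).real O) ω :=
      fun ω => Set.indicator_nonneg (fun ω _ => mul_nonneg U.prand_pos.le measureReal_nonneg) ω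
    rw [A.measureReal_inter_randomise s m hO.measurableSet hFm,
      setIntegral_pos_iff_support_of_nonneg_ae (ae_of_all _ hnn)
        (A.integrable_randomise s m hO.measurableSet).integrableOn]
    refine hFpos.trans_le (measure_mono fun ω hω => ⟨?_, hω⟩)
    have hY : A.Y s ω = m := hω.2.2
    have hu := U.u_pos m (A.opt s ω m) (by subst hY; exact A.opt_mem s ω) O hO hne
    have := U.u_markov m
    rw [Function.mem_support, Set.indicator_of_mem (by exact hY)]
    exact (mul_pos U.prand_pos (ENNReal.toReal_pos hu.ne' (measure_ne_top _ _))).ne'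
  refine h2.trans_le (measureReal_mono ?_)
  rintro ω ⟨⟨hω, -⟩, ⟨hY, -⟩, hp⟩
  exact ⟨hω, hY, hp⟩

/-- With positive probability the estimates are eventually close to their maximal values. -/
lemma exists_measure_pos_lt_estimates {η : ℝ} (hη : 0 < η) :
    ∃ (T : ℕ) (B : Set Ω), 0 < P B ∧ ∀ᵐ ω ∂P, ω ∈ B → ∀ m, D.pL m - η < A.estimates T ω m := by
  choose O hO hne hlt using fun m => D.exists_isOpen_lt_evaluate m hη
  have := D.nonempty
  -- A prescribed schedule of proposals: step `j` is to evaluate `y j` near its maximiser.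
  -- Surjectivity ensures that finitely many steps visit every model.
  obtain ⟨y, hy⟩ := exists_surjective_nat M
  have hstep (k : ℕ) : ∃ B : Set Ω, MeasurableSet[A.ℱ k] B ∧ 0 < P.real B ∧
      ∀ ω ∈ B, ∀ j < k, A.Y j ω = y j ∧ A.par j ω (y j) ∈ O (y j) := by
    induction k with
    | zero => exact ⟨Set.univ, MeasurableSet.univ, by simp, by simp⟩
    | succ k ih =>
      obtain ⟨B, hB, hpos, hmem⟩ := ih
      refine ⟨_, ?_, A.measureReal_inter_pos k (y k) (hO _) (hne _) hB hpos, ?_⟩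
      · refine (A.ℱ.mono (Nat.le_succ k) _ hB).inter (A.ℋ_le_ℱ k _ ?_)
        exact (A.𝒢_le_ℋ k _ (A.Y_meas k _)).inter (A.par_meas k _ (hO _).measurableSet)
      · rintro ω ⟨hω, h⟩ j hj
        rcases Nat.lt_succ_iff_lt_or_eq.1 hj with hj | rfl
        · exact hmem ω hω j hj
        · exact h
  choose g hg using hy
  set T := Finset.univ.sup g + 1
  obtain ⟨B, -, hpos, hmem⟩ := hstep T
  refine ⟨T, B, (ENNReal.toReal_pos_iff.1 hpos).1, ?_⟩
  filter_upwards [A.ae_par_mem] with ω hω hB m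
  have hgT : g m < T := Nat.lt_succ_of_le (Finset.le_sup (Finset.mem_univ m))
  obtain ⟨hY, hp⟩ := hmem ω hB (g m) hgT
  have h1 := hω (g m)
  have h2 := evaluate_le_bestEstimate D A.ε (fun k => A.Y k ω) (fun k => A.par k ω) (g m)
  rw [hg] at hY hp
  rw [hY] at h1 h2
  exact (hlt m _ ⟨hp, h1⟩).trans_le (h2.trans (monotone_bestEstimate D _ _ _ m hgT))

/-- The estimates increase to positive limits that are at most the maximal values. -/
lemma ae_exists_tendsto_estimates : ∀ᵐ ω ∂P, ∃ e : M → ℝ, (∀ m, 0 < e m) ∧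
    (∀ m, Tendsto (fun t => A.estimates t ω m) atTop (𝓝 (e m))) ∧
    ∀ t m, A.estimates t ω m ≤ e m ∧ e m ≤ D.pL m := by
  filter_upwards [A.ae_par_mem] with ω hω
  have hle (t : ℕ) (m : M) : A.estimates t ω m ≤ D.pL m :=
    bestEstimate_le_pL D _ _ _ A.ε_le hω t m
  have hmono (m : M) : Monotone fun t => A.estimates t ω m := monotone_bestEstimate D _ _ _ m
  have hbdd (m : M) : BddAbove (Set.range fun t => A.estimates t ω m) :=
    ⟨D.pL m, by rintro _ ⟨t, rfl⟩; exact hle t m⟩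
  refine ⟨fun m => ⨆ t, A.estimates t ω m, fun m => ?_, fun m =>
    tendsto_atTop_ciSup (hmono m) (hbdd m), fun t m => ⟨le_ciSup (hbdd m) t, ciSup_le (hle · m)⟩⟩
  exact (A.estimates_pos 0 ω m).trans_le (le_ciSup (hbdd m) 0)

variable [TopologicalSpace M] [DiscreteTopology M]

/-- If the adaptive kernels converge to a kernel that does not depend on chance, then the limits of
the estimates have the posterior of the maximal values. -/
lemma ae_exists_tendsto_estimates_posterior {V : M → ℝ} {C ρ : (M → ℝ) → ℝ}
    (hA3 : GeometricErgodicity (transition D Q) D.posterior {e | ∀ m, 0 < e m} V C ρ)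
    {elim : M → ℝ} (helim : ∀ m, 0 < elim m)
    (hconv : ∀ᵐ ω ∂P, KernelConvergence (transition D Q) C ρ (fun t => A.estimates t ω) elim) :
    ∀ᵐ ω ∂P, ∃ e : M → ℝ, (∀ m, 0 < e m) ∧
      (∀ m, Tendsto (fun t => A.estimates t ω m) atTop (𝓝 (e m))) ∧
      D.posterior e = D.posterior D.pL := by
  classical
  have hlim : ∀ᵐ ω ∂P, ∃ e : M → ℝ, (∀ m, 0 < e m) ∧
      (∀ m, Tendsto (fun t => A.estimates t ω m) atTop (𝓝 (e m))) ∧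
      (∀ t m, A.estimates t ω m ≤ e m ∧ e m ≤ D.pL m) ∧ D.posterior e = D.posterior elim := by
    filter_upwards [A.ae_exists_tendsto_estimates, hconv] with ω ⟨e, he, hte, hle⟩ hω
    refine ⟨e, he, hte, hle, hA3.stationary_eq he helim ?_⟩
    ext m m'
    -- Testing weak convergence on the indicator of `m'` gives convergence of the matrix entry;
    -- continuity in the estimates gives a second limit of the same sequence.
    have h1 := hω.weak (Pi.single m' 1) continuous_of_discreteTopology m
    simp only [Matrix.mulVec_single_one, Matrix.col_apply] at h1
    exact tendsto_nhds_unique (tendsto_transition D Q (A.estimates_pos · ω) he hte m m') h1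
  -- An event of positive probability meets the almost sure event, so one outcome supplies a
  -- deterministic vector near `pL` whose posterior is already that of `elim`.
  have hη (k : ℕ) : ∃ e : M → ℝ, (∀ m, |e m - D.pL m| ≤ 1 / ((k : ℝ) + 1)) ∧
      D.posterior e = D.posterior elim := by
    obtain ⟨T, B, hB, hlt⟩ := A.exists_measure_pos_lt_estimates (Nat.one_div_pos_of_nat (n := k))
    obtain ⟨ω, hω, h1, e, -, -, hle, hpost⟩ :=
      ((frequently_ae_mem_iff.2 hB.ne').and_eventually (hlt.and hlim)).exists
    refine ⟨e, fun m => ?_, hpost⟩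
    rw [abs_sub_comm, abs_of_nonneg (sub_nonneg.2 (hle T m).2)]
    linarith [h1 hω m, (hle T m).1]
  choose e he hpost using hη
  have hkey : D.posterior D.pL = D.posterior elim := by
    ext m
    have h1 (m : M) : Tendsto (fun k => e k m) atTop (𝓝 (D.pL m)) := by
      rw [tendsto_iff_dist_tendsto_zero]
      exact squeeze_zero (fun _ => dist_nonneg) (fun k => he k m)
        tendsto_one_div_add_atTop_nhds_zero_nat
    have h2 := D.tendsto_posterior A.pL_pos h1 m
    simp only [hpost] at h2
    exact tendsto_nhds_unique h2 tendsto_const_nhds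
  filter_upwards [hlim] with ω ⟨e, he, hte, _, hp⟩
  exact ⟨e, he, hte, hp.trans hkey.symm⟩

/-- Along almost every run the acceptance probabilities approach those of the target. -/
lemma ae_tendsto_acceptProb {V : M → ℝ} {C ρ : (M → ℝ) → ℝ}
    (hA3 : GeometricErgodicity (transition D Q) D.posterior {e | ∀ m, 0 < e m} V C ρ)
    {elim : M → ℝ} (helim : ∀ m, 0 < elim m)
    (hconv : ∀ᵐ ω ∂P, KernelConvergence (transition D Q) C ρ (fun t => A.estimates t ω) elim) :
    ∀ᵐ ω ∂P, Tendsto (fun s =>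
      acceptProb D Q (A.estimates (s + 1) ω) (A.comp s ω) (A.X s ω) (A.Y s ω)
        - acceptProb D Q D.pL (A.comp s ω) (A.X s ω) (A.Y s ω)) atTop (𝓝 0) := by
  filter_upwards [A.ae_exists_tendsto_estimates_posterior hA3 helim hconv]
    with ω ⟨e, he, hte, hp⟩
  -- The state and the proposal change with `s`, so the error is bounded by its sum over all pairs
  -- of models; each summand tends to zero since the limit has the ratios of `pL`.
  set b : ℕ → M × M → ℝ := fun s p =>
    |A.estimates (s + 1) ω p.2 / A.estimates (s + 1) ω p.1 / (D.pL p.2 / D.pL p.1) - 1|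
  have hb : Tendsto (fun s => ∑ p, b s p) atTop (𝓝 (∑ _p : M × M, |(1 : ℝ) - 1|)) := by
    refine tendsto_finsetSum _ fun p _ => ?_
    have hpos : 0 < D.pL p.2 / D.pL p.1 := div_pos (A.pL_pos _) (A.pL_pos _)
    have h1 := ((((tendsto_add_atTop_iff_nat 1).2 (hte p.2)).div
      ((tendsto_add_atTop_iff_nat 1).2 (hte p.1)) (he p.1).ne').div_const
        (D.pL p.2 / D.pL p.1))
    rw [D.div_eq_div_of_posterior_eq he A.pL_pos hp, div_self hpos.ne'] at h1
    exact (h1.sub_const 1).abs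
  simp only [sub_self, abs_zero, Finset.sum_const_zero] at hb
  refine squeeze_zero_norm (fun s => ?_) hb
  refine (abs_acceptProb_sub_le D Q (A.estimates_pos (s + 1) ω) A.pL_pos _ _ _).trans ?_
  exact Finset.single_le_sum (f := b s) (fun p _ => abs_nonneg _)
    (Finset.mem_univ (A.X s ω, A.Y s ω))

end Run

/-! ### Conditional law of the proposal step -/

lemma measurable_comp_of_measurableSet_fiber {Ω β : Type*} {m : MeasurableSpace Ω} [Countable β]
    {g : Ω → β} (hg : ∀ b, MeasurableSet {ω | g ω = b}) (f : β → ℝ) :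
    Measurable fun ω => f (g ω) := by
  let _ : MeasurableSpace β := ⊤
  exact (measurable_from_top (f := f)).comp (measurable_to_countable' hg)

namespace Run

variable {M : Type*} [Fintype M] {R : Type*} {D : ModelClass M} {Q : ProposalMixture M R}
  {U : Randomisation D} {Ω : Type*} [mΩ : MeasurableSpace Ω] {P : Measure Ω} (A : Run D Q U P)

lemma measurable_comp_state (s : ℕ) (f : M → ℝ) : Measurable[A.ℱ s] fun ω => f (A.X s ω) :=
  measurable_comp_of_measurableSet_fiber (A.X_meas s) f

lemma measurable_comp_proposal [Countable R] (s : ℕ) (f : M → R → M → ℝ) :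
    Measurable[A.𝒢 s] fun ω => f (A.X s ω) (A.comp s ω) (A.Y s ω) := by
  refine measurable_comp_of_measurableSet_fiber (m := A.𝒢 s)
    (g := fun ω => (A.X s ω, A.comp s ω, A.Y s ω)) (fun p => ?_) fun p => f p.1 p.2.1 p.2.2
  have : {ω | (A.X s ω, A.comp s ω, A.Y s ω) = p}
      = {ω | A.X s ω = p.1} ∩ ({ω | A.comp s ω = p.2.1} ∩ {ω | A.Y s ω = p.2.2}) := by
    ext ω
    simp [Prod.ext_iff]
  rw [this]
  exact (A.ℱ_le_𝒢 s _ (A.X_meas s _)).inter ((A.comp_meas s _).inter (A.Y_meas s _))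

variable [IsProbabilityMeasure P] [Countable R]

/-- Conditional expectation, given the past, of a bounded function of the state, the mixture
component and the proposal. -/
lemma condExp_comp_proposal (s : ℕ) {f : M → R → M → ℝ} {c : ℝ} (hf : ∀ x r y, |f x r y| ≤ c) :
    P[fun ω => f (A.X s ω) (A.comp s ω) (A.Y s ω) | A.ℱ s]
      =ᵐ[P] fun ω => ∑ y, ∑' r, Q.w r * Q.q r (A.X s ω) y * f (A.X s ω) r y := by
  classical
  -- These countably many events partition the space. On each piece the function depends on the past
  -- only through the current state, so the proposal law applies; the bound `c * Q.w p.1` permits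
  -- summation under the integral.
  set E : R × M → Set Ω := fun p => {ω | A.comp s ω = p.1 ∧ A.Y s ω = p.2} with hE
  have hEm (p : R × M) : MeasurableSet (E p) :=
    A.𝒢_le s _ ((A.comp_meas s p.1).inter (A.Y_meas s p.2))
  have hc : 0 ≤ c :=
    have ⟨r, _⟩ := Q.exists_pos
    have ⟨m⟩ := D.nonempty
    (abs_nonneg _).trans (hf m r m)
  have hfm (p : R × M) : Measurable[A.ℱ s] fun ω => f (A.X s ω) p.1 p.2 :=
    A.measurable_comp_state s fun x => f x p.1 p.2
  have hone (p : R × M) : Integrable ((E p).indicator fun _ => (1 : ℝ)) P :=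
    (integrable_const _).indicator (hEm p)
  set F : R × M → Ω → ℝ := fun p ω => f (A.X s ω) p.1 p.2 * (E p).indicator (fun _ => 1) ω with hF
  set G : R × M → Ω → ℝ := fun p ω => f (A.X s ω) p.1 p.2 * (Q.w p.1 * Q.q p.1 (A.X s ω) p.2)
    with hG
  have hFi (p : R × M) : Integrable (F p) P :=
    (hone p).bdd_mul ((hfm p).mono (A.ℱ.le s) le_rfl).aestronglyMeasurable
      (ae_of_all _ fun ω => hf _ _ _)
  have hFG (p : R × M) : P[F p | A.ℱ s] =ᵐ[P] G p := by
    filter_upwards [condExp_mul_of_stronglyMeasurable_left (hfm p).stronglyMeasurable (hFi p)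
      (hone p), A.proposal_law s p.1 p.2] with ω h1 h2
    refine h1.trans ?_
    rw [Pi.mul_apply, h2]
  have hGi (p : R × M) : Integrable (G p) P := integrable_condExp.congr (hFG p)
  have hbound : Summable fun p : R × M => c * Q.w p.1 :=
    (Summable.mul_left c (by
      have h := Q.w_sum.summable.mul_of_nonneg (g := fun _ : M => (1 : ℝ)) (Summable.of_finite)
        Q.w_nonneg (fun _ => zero_le_one)
      simpa using h))
  have hwq (p : R × M) (x : M) : 0 ≤ Q.w p.1 * Q.q p.1 x p.2 :=
    mul_nonneg (Q.w_nonneg _) (Q.q_nonneg _ _ _)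
  have hwq' (p : R × M) (x : M) : Q.w p.1 * Q.q p.1 x p.2 ≤ Q.w p.1 :=
    mul_le_of_le_one_right (Q.w_nonneg _) (Q.q_le_one _ _ _)
  have hGb (p : R × M) (ω : Ω) : ‖G p ω‖ ≤ c * Q.w p.1 := by
    rw [hG, norm_mul, Real.norm_eq_abs, Real.norm_of_nonneg (hwq _ _)]
    exact mul_le_mul (hf _ _ _) (hwq' _ _) (hwq _ _) hc
  have hFb (p : R × M) : ∫ ω, ‖F p ω‖ ∂P ≤ c * Q.w p.1 := by
    calc ∫ ω, ‖F p ω‖ ∂P ≤ ∫ ω, c * (E p).indicator (fun _ => (1 : ℝ)) ω ∂P := by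
          refine integral_mono (hFi p).norm ((hone p).const_mul c) fun ω => ?_
          have h0 : 0 ≤ (E p).indicator (fun _ => (1 : ℝ)) ω :=
            Set.indicator_nonneg (fun _ _ => zero_le_one) _
          simp only [hF, norm_mul, Real.norm_of_nonneg h0]
          exact mul_le_mul_of_nonneg_right (hf _ _ _) h0
      _ = c * ∫ ω, Q.w p.1 * Q.q p.1 (A.X s ω) p.2 ∂P := by
          rw [integral_const_mul, ← integral_congr_ae (A.proposal_law s p.1 p.2),
            integral_condExp (A.ℱ.le s)]
      _ ≤ c * ∫ _ω, Q.w p.1 ∂P := by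
          refine mul_le_mul_of_nonneg_left ?_ hc
          exact integral_mono (integrable_condExp.congr (A.proposal_law s p.1 p.2))
            (integrable_const _) fun ω => hwq' _ _
      _ = c * Q.w p.1 := by simp
  have hFsum : Summable fun p => ∫ ω, ‖F p ω‖ ∂P :=
    Summable.of_nonneg_of_le (fun p => integral_nonneg fun ω => norm_nonneg _) hFb hbound
  have hGsum : Summable fun p => ∫ ω, ‖G p ω‖ ∂P := by
    refine Summable.of_nonneg_of_le (fun p => integral_nonneg fun ω => norm_nonneg _)
      (fun p => ?_) hbound
    calc ∫ ω, ‖G p ω‖ ∂P ≤ ∫ _ω, c * Q.w p.1 ∂P :=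
          integral_mono (hGi p).norm (integrable_const _) (hGb p)
      _ = c * Q.w p.1 := by simp
  have hFt (ω : Ω) : f (A.X s ω) (A.comp s ω) (A.Y s ω) = ∑' p, F p ω := by
    rw [tsum_eq_single (A.comp s ω, A.Y s ω)]
    · simp [hF, hE]
    · rintro ⟨r, y⟩ hp
      have : ω ∉ E (r, y) := fun h => hp (Prod.ext h.1.symm h.2.symm)
      simp [hF, this]
  have hGt (ω : Ω) : ∑ y, ∑' r, Q.w r * Q.q r (A.X s ω) y * f (A.X s ω) r y = ∑' p, G p ω := by
    have hs : Summable fun p => G p ω := Summable.of_norm_bounded hbound (hGb · ω)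
    have hs' : Summable fun p : M × R => G (p.2, p.1) ω := (Equiv.prodComm M R).summable_iff.2 hs
    rw [← (Equiv.prodComm M R).tsum_eq]
    refine Eq.trans ?_ hs'.tsum_prod.symm
    rw [tsum_fintype]
    refine Finset.sum_congr rfl fun y _ => tsum_congr fun r => ?_
    simp [hG, mul_comm]
  have hset (H : R × M → Ω → ℝ) (hH : ∀ p, Integrable (H p) P)
      (hs : Summable fun p => ∫ ω, ‖H p ω‖ ∂P) (B : Set Ω) :
      ∫ ω in B, ∑' p, H p ω ∂P = ∑' p, ∫ ω in B, H p ω ∂P := by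
    refine (integral_tsum_of_summable_integral_norm (fun p => (hH p).integrableOn)
      (Summable.of_nonneg_of_le (fun p => integral_nonneg fun ω => norm_nonneg _)
        (fun p => ?_) hs)).symm
    exact setIntegral_le_integral (hH p).norm (ae_of_all _ fun ω => norm_nonneg _)
  have hgm : Measurable[A.ℱ s]
      fun ω => ∑ y, ∑' r, Q.w r * Q.q r (A.X s ω) y * f (A.X s ω) r y :=
    A.measurable_comp_state s fun x => ∑ y, ∑' r, Q.w r * Q.q r x y * f x r y
  refine (ae_eq_condExp_of_forall_setIntegral_eq (A.ℱ.le s) ?_ (fun B _ _ => ?_)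
    (fun B hB _ => ?_) hgm.stronglyMeasurable.aestronglyMeasurable).symm
  · exact Integrable.of_bound (C := c)
      ((A.measurable_comp_proposal s f).mono (A.𝒢_le s) le_rfl).aestronglyMeasurable
      (ae_of_all _ fun ω => hf _ _ _)
  · refine (Integrable.of_bound (C := ∑' p : R × M, c * Q.w p.1)
      (hgm.mono (A.ℱ.le s) le_rfl).aestronglyMeasurable (ae_of_all _ fun ω => ?_)).integrableOn
    rw [hGt]
    exact tsum_of_norm_bounded hbound.hasSum (hGb · ω)
  · simp_rw [hGt, hFt]
    rw [hset G hGi hGsum, hset F hFi hFsum]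
    refine tsum_congr fun p => ?_
    rw [← setIntegral_condExp (A.ℱ.le s) (hFi p) hB]
    exact (integral_congr_ae (ae_restrict_of_ae (hFG p))).symm

end Run

/-! ### Martingale decomposition of the indicator increments -/

namespace Run

variable {M : Type*} [Fintype M] {R : Type*} {D : ModelClass M} {Q : ProposalMixture M R}
  {U : Randomisation D} {Ω : Type*} [mΩ : MeasurableSpace Ω] {P : Measure Ω} (A : Run D Q U P)
  [IsProbabilityMeasure P] [Countable R]

open Classical in
/-- The change of the indicator of a state is, up to averages that vanish, the change expected
under the kernel of the target. -/
lemma ae_tendsto_average_transition_sub (m : M)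
    (hacc : ∀ᵐ ω ∂P, Tendsto (fun s =>
      acceptProb D Q (A.estimates (s + 1) ω) (A.comp s ω) (A.X s ω) (A.Y s ω)
        - acceptProb D Q D.pL (A.comp s ω) (A.X s ω) (A.Y s ω)) atTop (𝓝 0)) :
    ∀ᵐ ω ∂P, Tendsto (fun t : ℕ => (∑ s ∈ Finset.range t,
      (transition D Q D.pL (A.X s ω) m - if A.X s ω = m then 1 else 0)) / t) atTop (𝓝 0) := by
  set g : M → M → ℝ := fun x y => (if y = m then 1 else 0) - if x = m then 1 else 0 with hg
  have hg1 (x y : M) : |g x y| ≤ 1 := by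
    simp only [hg]
    split_ifs <;> simp
  set I : ℕ → Ω → ℝ := fun s => (A.acc s).indicator fun _ => 1 with hI
  set a : ℕ → Ω → ℝ := fun s => P[I s | A.ℋ s]
  set b : M → R → M → ℝ := fun x r y => acceptProb D Q D.pL r x y * g x y with hb
  have hb1 (x : M) (r : R) (y : M) : |b x r y| ≤ 1 := by
    rw [hb, abs_mul]
    exact mul_le_one₀ (abs_acceptProb_le_one D Q A.pL_pos _ _ _) (abs_nonneg _) (hg1 _ _)
  set k : M → ℝ := fun x => transition D Q D.pL x m - if x = m then 1 else 0 with hk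
  have hIm (s : ℕ) : StronglyMeasurable[A.ℱ (s + 1)] (I s) :=
    stronglyMeasurable_const.indicator (A.acc_meas s)
  have hIi (s : ℕ) : Integrable (I s) P := (integrable_const _).indicator (A.ℱ.le _ _ (A.acc_meas s))
  have hI1 (s : ℕ) (ω : Ω) : 0 ≤ I s ω ∧ I s ω ≤ 1 :=
    ⟨Set.indicator_nonneg (fun _ _ => zero_le_one) _,
      Set.indicator_le_self' (fun _ _ => zero_le_one) ω⟩
  have haeq (s : ℕ) : ∀ᵐ ω ∂P, a s ω
      = acceptProb D Q (A.estimates (s + 1) ω) (A.comp s ω) (A.X s ω) (A.Y s ω) :=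
    A.accept_law s
  have hgm (s : ℕ) : StronglyMeasurable[A.𝒢 s] fun ω => g (A.X s ω) (A.Y s ω) :=
    (A.measurable_comp_proposal s fun x _ y => g x y).stronglyMeasurable
  have hbm (s : ℕ) : StronglyMeasurable[A.𝒢 s] fun ω => b (A.X s ω) (A.comp s ω) (A.Y s ω) :=
    (A.measurable_comp_proposal s b).stronglyMeasurable
  have hkm (s : ℕ) : StronglyMeasurable[A.ℱ s] fun ω => k (A.X s ω) :=
    (A.measurable_comp_state s k).stronglyMeasurable
  have hcond (s : ℕ) : P[fun ω => b (A.X s ω) (A.comp s ω) (A.Y s ω) | A.ℱ s]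
      =ᵐ[P] fun ω => k (A.X s ω) := by
    refine (A.condExp_comp_proposal s hb1).trans (ae_of_all _ fun ω => ?_)
    refine Eq.trans ?_ (sum_moveProb_mul_indicator_sub D Q D.pL (A.X s ω) m)
    simp only [hb, hg, moveProb, ← tsum_mul_right, mul_assoc]
  -- `d₁` is the acceptance noise, centred given `A.ℋ s` and hence given `A.ℱ s`; `d₂` is the noise
  -- of component and proposal, centred given `A.ℱ s`. In `d₂` the acceptance probability is already
  -- that of the target, so its compensator `k` depends on the state alone.
  set d₁ : ℕ → Ω → ℝ := fun s ω => g (A.X s ω) (A.Y s ω) * (I s ω - a s ω) with hd₁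
  set d₂ : ℕ → Ω → ℝ := fun s ω => b (A.X s ω) (A.comp s ω) (A.Y s ω) - k (A.X s ω) with hd₂
  have h₁ : ∀ᵐ ω ∂P, Tendsto (fun t : ℕ => (∑ s ∈ Finset.range t, d₁ s ω) / t) atTop (𝓝 0) := by
    have hbd (s : ℕ) : ∀ᵐ ω ∂P, |d₁ s ω| ≤ 1 := by
      filter_upwards [haeq s] with ω hω
      have h0 := acceptProb_nonneg D Q (A.estimates_pos (s + 1) ω) (A.comp s ω) (A.X s ω) (A.Y s ω)
      have h1 := acceptProb_le_one D Q (A.estimates (s + 1) ω) (A.comp s ω) (A.X s ω) (A.Y s ω)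
      rw [hd₁, abs_mul]
      refine mul_le_one₀ (hg1 _ _) (abs_nonneg _) (abs_le.2 ?_)
      rw [hω]
      constructor <;> linarith [(hI1 s ω).1, (hI1 s ω).2]
    have hm (s : ℕ) : StronglyMeasurable[A.ℱ (s + 1)] (d₁ s) :=
      ((hgm s).mono ((A.𝒢_le_ℋ s).trans (A.ℋ_le_ℱ s))).mul
        ((hIm s).sub (stronglyMeasurable_condExp.mono (A.ℋ_le_ℱ s)))
    refine ae_tendsto_average_of_condExp_eq_zero A.ℱ hm hbd fun s => ?_
    have hi : Integrable (I s - a s) P := (hIi s).sub integrable_condExp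
    have hdi : Integrable (d₁ s) P :=
      Integrable.of_bound (C := 1) ((hm s).mono (A.ℱ.le _)).aestronglyMeasurable (hbd s)
    have h0 : P[d₁ s | A.ℋ s] =ᵐ[P] 0 := by
      filter_upwards [condExp_mul_of_stronglyMeasurable_left ((hgm s).mono (A.𝒢_le_ℋ s)) hdi hi,
        condExp_sub (hIi s) (integrable_condExp (f := I s) (m := A.ℋ s)) (A.ℋ s)] with ω h1 h2
      refine h1.trans ?_
      have h3 : P[fun ω => I s ω - a s ω | A.ℋ s] ω = 0 := by
        refine h2.trans ?_
        rw [Pi.sub_apply, condExp_of_stronglyMeasurable (A.ℋ_le s)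
          stronglyMeasurable_condExp integrable_condExp, sub_self]
      rw [Pi.mul_apply, h3, mul_zero, Pi.zero_apply]
    calc P[d₁ s | A.ℱ s] =ᵐ[P] P[P[d₁ s | A.ℋ s] | A.ℱ s] :=
          (condExp_condExp_of_le ((A.ℱ_le_𝒢 s).trans (A.𝒢_le_ℋ s)) (A.ℋ_le s)).symm
      _ =ᵐ[P] P[(0 : Ω → ℝ) | A.ℱ s] := condExp_congr_ae h0
      _ = 0 := condExp_zero
  have h₂ : ∀ᵐ ω ∂P, Tendsto (fun t : ℕ => (∑ s ∈ Finset.range t, d₂ s ω) / t) atTop (𝓝 0) := by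
    -- The compensator is a conditional expectation of `b`, so it inherits the bound 1.
    have hk1 (s : ℕ) : ∀ᵐ ω ∂P, |k (A.X s ω)| ≤ 1 := by
      filter_upwards [hcond s, ae_bdd_abs_condExp_of_ae_bdd_abs (m := A.ℱ s) (R := (1 : ℝ))
        (ae_of_all P fun ω => hb1 (A.X s ω) (A.comp s ω) (A.Y s ω))] with ω h1 h2
      rwa [← h1]
    have hbi (s : ℕ) : Integrable (fun ω => b (A.X s ω) (A.comp s ω) (A.Y s ω)) P :=
      Integrable.of_bound (C := 1) ((hbm s).mono (A.𝒢_le s)).aestronglyMeasurable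
        (ae_of_all _ fun ω => hb1 _ _ _)
    have hki (s : ℕ) : Integrable (fun ω => k (A.X s ω)) P :=
      integrable_condExp.congr (hcond s)
    refine ae_tendsto_average_of_condExp_eq_zero A.ℱ (c := 2) (fun s => ?_) (fun s => ?_)
      fun s => ?_
    · exact ((hbm s).mono ((A.𝒢_le_ℋ s).trans (A.ℋ_le_ℱ s))).sub
        ((hkm s).mono (A.ℱ.mono (Nat.le_succ s)))
    · filter_upwards [hk1 s] with ω hω
      have := abs_sub (b (A.X s ω) (A.comp s ω) (A.Y s ω)) (k (A.X s ω))
      linarith [hb1 (A.X s ω) (A.comp s ω) (A.Y s ω)]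
    · filter_upwards [condExp_sub (hbi s) (hki s) (A.ℱ s), hcond s] with ω h1 h2
      refine h1.trans ?_
      rw [Pi.sub_apply, h2, condExp_of_stronglyMeasurable (A.ℱ.le s) (hkm s) (hki s), sub_self]
      rfl
  filter_upwards [h₁, h₂, hacc, ae_all_iff.2 haeq] with ω h1 h2 h3 h4
  -- The price of using the target's acceptance probability instead of the adaptive one; it tends to
  -- zero, and so do its Cesàro means.
  set e : ℕ → ℝ := fun s =>
    g (A.X s ω) (A.Y s ω) * (a s ω - acceptProb D Q D.pL (A.comp s ω) (A.X s ω) (A.Y s ω)) with he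
  have h5 : Tendsto e atTop (𝓝 0) := by
    refine squeeze_zero_norm (fun s => ?_) (tendsto_zero_iff_abs_tendsto_zero _ |>.1 h3)
    simp only [he, Real.norm_eq_abs, abs_mul, h4, Function.comp_apply]
    exact mul_le_of_le_one_left (abs_nonneg _) (hg1 _ _)
  have h6 : Tendsto (fun t : ℕ => ((if A.X t ω = m then (1 : ℝ) else 0)
      - if A.X 0 ω = m then (1 : ℝ) else 0) / t) atTop (𝓝 0) := by
    refine squeeze_zero_norm (a := fun t : ℕ => 1 / (t : ℝ)) (fun t => ?_)
      tendsto_one_div_atTop_nhds_zero_nat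
    rw [norm_div, Real.norm_natCast]
    gcongr
    split_ifs <;> simp
  have h7 := ((h6.sub h1).sub h2).sub h5.cesaro
  simp only [sub_zero] at h7
  refine h7.congr fun t => ?_
  have hstep (s : ℕ) : k (A.X s ω) = (((if A.X (s + 1) ω = m then (1 : ℝ) else 0)
      - if A.X s ω = m then (1 : ℝ) else 0) - d₁ s ω - d₂ s ω) - e s := by
    have h8 : (if A.X (s + 1) ω = m then (1 : ℝ) else 0) - (if A.X s ω = m then (1 : ℝ) else 0)
        = I s ω * g (A.X s ω) (A.Y s ω) := by
      by_cases hs : ω ∈ A.acc s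
      · rw [A.X_succ_of_acc s ω hs]
        simp [hI, hs, hg]
      · rw [A.X_succ_of_not_acc s ω hs]
        simp [hI, hs]
    rw [h8]
    simp only [hd₁, hd₂, he, hb]
    ring
  have hsum : ∑ s ∈ Finset.range t, k (A.X s ω)
      = (((if A.X t ω = m then (1 : ℝ) else 0) - if A.X 0 ω = m then (1 : ℝ) else 0)
        - ∑ s ∈ Finset.range t, d₁ s ω - ∑ s ∈ Finset.range t, d₂ s ω)
        - ∑ s ∈ Finset.range t, e s := by
    rw [Finset.sum_congr rfl fun s _ => hstep s, Finset.sum_sub_distrib, Finset.sum_sub_distrib,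
      Finset.sum_sub_distrib, Finset.sum_range_sub fun s => if A.X s ω = m then (1 : ℝ) else 0]
  rw [hsum]
  ring

end Run

end SubsamplingMCMC

theorem mainTheorem4 {M : Type*} [Fintype M] [TopologicalSpace M] [DiscreteTopology M]
    {R : Type*} [Countable R]
    (D : SubsamplingMCMC.ModelClass M)
    (Q : SubsamplingMCMC.ProposalMixture M R)
    (U : SubsamplingMCMC.Randomisation D)
    {Ω : Type*} [MeasurableSpace Ω] (P : Measure Ω) [IsProbabilityMeasure P]
    (A : SubsamplingMCMC.Run D Q U P)
    (V : M → ℝ) (C ρ : (M → ℝ) → ℝ)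
    (hA3 : SubsamplingMCMC.GeometricErgodicity (SubsamplingMCMC.transition D Q) D.posterior
      {e | ∀ m, 0 < e m} V C ρ)
    (elim : M → ℝ) (helim : ∀ m, 0 < elim m)
    (hconv : ∀ᵐ ω ∂P, SubsamplingMCMC.KernelConvergence (SubsamplingMCMC.transition D Q) C ρ
      (fun t => A.estimates t ω) elim) :
    ∀ᵐ ω ∂P, ∀ m, Tendsto (fun t => A.mcEstimate t ω m) atTop (𝓝 (D.target m)) := by
  classical
  filter_upwards [ae_all_iff.2 fun m => A.ae_tendsto_average_transition_sub m
    (A.ae_tendsto_acceptProb hA3 helim hconv)] with ω hω m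
  refine SubsamplingMCMC.tendsto_frequency_of_average_invariant
    (SubsamplingMCMC.transition D Q D.pL) (D.posterior D.pL) (fun s => A.X s ω)
    (fun x y => hA3.tendsto_pow (e := D.pL) A.pL_pos x y) (fun y => ?_) m
  exact hω y
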